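/- A \emph{proximity} on a set $X$ is a relation $\delta$ between subsets of $X$ such that for all $A,B,C\subseteq X$: (1) $A\,\delta\,B\Rightarrow B\,\delta\,A$; (2) $A\,\delta\,B\Rightarrow A\neq\emptyset\neq B$; (3) $A\cap B\ne\emptyset\Rightarrow A\,\delta\,B$; (4) $A\,\delta\,(B\cup C)\iff A\,\delta\,B$ or $A\,\delta\,C$; (5) if not $A\,\delta\,B$, there is $E\subseteq X$ with neither $A\,\delta\,E$ nor $(X\setminus E)\,\delta\,B$. It is \emph{separated} if $\{x\}\,\delta\,\{y\}\iff x=y$. A \emph{proximity base} of $(X,\delta)$ is a family $\mathcal P$ of subsets of $X$ such that whenever not $A\,\delta\,B$, there are $C,D\in\mathcal P$ with $A\subseteq C$, $B\subseteq D$ and not $C\,\delta\,D$; the \emph{proximity weight} of $(X,\delta)$ is the smallest cardinal $\kappa$ such that there is a proximity base of cardinality at most $\kappa$. A \emph{cluster} in a separated proximity space $(X,\delta)$ is a nonempty collection $\sigma$ of subsets of $X$ such that $A\,\delta\,B$ for all $A,B\in\sigma$; every $C$ with $C\,\delta\,A$ for all $A\in\sigma$ belongs to $\sigma$; and $A\cup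 B\in\sigma$ implies $A\in\sigma$ or $B\in\sigma$. The \emph{Smirnov compactification} of $(X,\delta)$ is the set of its clusters with the proximity $\delta^*$ for which $\mathcal A\,\delta^*\,\mathcal B$ if and only if $A\,\delta\,B$ for all $A,B\subseteq X$ such that $A$ belongs to every cluster in $\mathcal A$ and $B$ to every cluster in $\mathcal B$. The \emph{coproduct} of proximity spaces $(X_\alpha,\delta_\alpha)_{\alpha\in I}$ is the disjoint union $\coprod_\alpha X_\alpha$ with the proximity $\delta$ for which $A\,\delta\,B$ if and only if $(A\cap X_\alpha)\,\delta_\alpha\,(B\cap X_\alpha)$ for some $\alpha$. The \emph{metric proximity} of a metric $d$ is given by $A\,\delta_d\,B\iff d(A,B)=0$, where $d(A,B)=\inf\{d(a,b): a\in A,\ b\in B\}$ and $d(A,B)=\infty$ if $A$ or $B$ is empty. \textbf{Corollary.} Let $(X_\alpha,\delta_\alpha)_{\alpha\in I}$ be a family of separated proximity spaces, infinitely many of which are nonempty (for instance, any infinite family of nonempty separated proximity spaces). Let $(\coprod_\alpha X_\alpha,\delta)$ be its coproduct and $(\overline{\coprod_\alpha X_\alpha},\delta^*)$ the Smirnov compactification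 of the coproduct. Then the proximity weights of $(\coprod_\alpha X_\alpha,\delta)$ and of $(\overline{\coprod_\alpha X_\alpha},\delta^*)$ are both strictly larger than $\aleph_0$. Moreover, $\delta$ is not the metric proximity of any totally bounded metric on $\coprod_\alpha X_\alpha$. -/

import Mathlib

universe u v

/-- A proximity on a set `X`: a relation "`A` is close to `B`" between subsets of `X`. -/
structure Proximity (X : Type u) where
  Near : Set X → Set X → Prop
  symm : ∀ A B, Near A B → Near B A
  nonempty : ∀ A B, Near A B → A.Nonempty ∧ B.Nonempty
  of_inter : ∀ A B, (A ∩ B).Nonempty → Near A B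
  union : ∀ A B C, Near A (B ∪ C) ↔ Near A B ∨ Near A C
  exists_far : ∀ A B, ¬ Near A B → ∃ E, ¬ Near A E ∧ ¬ Near Eᶜ B

namespace Proximity

/-- A proximity is separated if distinct points are not close. -/
def Separated {X : Type u} (δ : Proximity X) : Prop :=
  ∀ x y : X, δ.Near {x} {y} ↔ x = y

theorem near_mono {X : Type u} (δ : Proximity X) {A B C : Set X} (h : δ.Near A B) (hBC : B ⊆ C) :
    δ.Near A C := by
  rw [← Set.union_eq_self_of_subset_left hBC, δ.union]
  exact Or.inl h

/-- A proximity base: a family `P` of subsets of `X` such that any two sets that are not close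
are contained in two members of `P` that are not close. -/
def IsBase {X : Type u} (δ : Proximity X) (P : Set (Set X)) : Prop :=
  ∀ A B, ¬ δ.Near A B → ∃ C ∈ P, ∃ D ∈ P, A ⊆ C ∧ B ⊆ D ∧ ¬ δ.Near C D

/-- The proximity weight: the least cardinal `κ` such that there is a proximity base of
cardinality at most `κ`. The set of such `κ` is nonempty, as the family of all subsets is a base,
and cardinals are well-ordered, so the infimum is a minimum. -/
noncomputable def weight {X : Type u} (δ : Proximity X) : Cardinal.{u} :=
  sInf {κ : Cardinal.{u} | ∃ P : Set (Set X), δ.IsBase P ∧ Cardinal.mk P ≤ κ}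

/-- The coproduct of a family of proximity spaces, on the disjoint union `Σ i, X i`: two sets are
close if and only if their traces on some summand are close. -/
def coproduct {ι : Type u} {X : ι → Type v} (δ : ∀ i, Proximity (X i)) :
    Proximity (Σ i, X i) where
  Near A B := ∃ i, (δ i).Near (Sigma.mk i ⁻¹' A) (Sigma.mk i ⁻¹' B)
  symm := fun _ _ ⟨i, h⟩ => ⟨i, (δ i).symm _ _ h⟩
  nonempty := fun _ _ ⟨i, h⟩ =>
    ⟨((δ i).nonempty _ _ h).1.imp' (Sigma.mk i) fun _ h => h,
      ((δ i).nonempty _ _ h).2.imp' (Sigma.mk i) fun _ h => h⟩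
  of_inter := fun _ _ ⟨⟨i, x⟩, h⟩ => ⟨i, (δ i).of_inter _ _ ⟨x, h⟩⟩
  union := by
    intro A B C
    simp only [Set.preimage_union, (δ _).union, exists_or]
  exists_far := by
    intro A B h
    have h' : ∀ i, ¬ (δ i).Near (Sigma.mk i ⁻¹' A) (Sigma.mk i ⁻¹' B) := not_exists.mp h
    choose E hE using fun i => (δ i).exists_far _ _ (h' i)
    exact ⟨{p | p.2 ∈ E p.1}, fun ⟨i, hi⟩ => (hE i).1 hi, fun ⟨i, hi⟩ => (hE i).2 hi⟩

/-- Clusters of a (separated) proximity space: the points of its Smirnov compactification. -/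
@[ext]
structure Cluster {X : Type u} (δ : Proximity X) where
  sets : Set (Set X)
  nonempty : sets.Nonempty
  near : ∀ A ∈ sets, ∀ B ∈ sets, δ.Near A B
  mem_of_near : ∀ C, (∀ A ∈ sets, δ.Near C A) → C ∈ sets
  mem_or_mem : ∀ A B, A ∪ B ∈ sets → A ∈ sets ∨ B ∈ sets

namespace Cluster

variable {X : Type u} {δ : Proximity X}

theorem mem_mono (σ : δ.Cluster) {A B : Set X} (hA : A ∈ σ.sets) (h : A ⊆ B) : B ∈ σ.sets :=
  σ.mem_of_near B fun C hC => δ.symm _ _ (δ.near_mono (σ.near C hC A hA) h)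

theorem mem_or_compl_mem (σ : δ.Cluster) (A : Set X) : A ∈ σ.sets ∨ Aᶜ ∈ σ.sets := by
  obtain ⟨B, hB⟩ := σ.nonempty
  exact σ.mem_or_mem A Aᶜ (by simpa using σ.mem_mono hB (Set.subset_univ B))

end Cluster

/-- A subset `C` of `X` absorbs a set of clusters if it belongs to each of them. -/
def Absorbs {X : Type u} {δ : Proximity X} (C : Set X) (S : Set δ.Cluster) : Prop :=
  ∀ σ ∈ S, C ∈ σ.sets

/-- The Smirnov compactification of a (separated) proximity space `(X, δ)`: the set of all its
clusters with the proximity `δ*`, where `S δ* T` if and only if `A δ B` for all subsets `A`, `B`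
of `X` that absorb `S` and `T`. -/
def smirnov {X : Type u} (δ : Proximity X) : Proximity δ.Cluster where
  Near S T := ∀ A B : Set X, Absorbs A S → Absorbs B T → δ.Near A B
  symm S T h A B hA hB := δ.symm _ _ (h B A hB hA)
  nonempty S T h := by
    constructor
    · by_contra hS
      rw [Set.not_nonempty_iff_eq_empty] at hS
      subst hS
      exact Set.not_nonempty_empty
        (δ.nonempty _ _ (h ∅ Set.univ (fun σ hσ => hσ.elim)
          fun σ _ => σ.mem_mono σ.nonempty.some_mem (Set.subset_univ _))).1
    · by_contra hT
      rw [Set.not_nonempty_iff_eq_empty] at hT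
      subst hT
      exact Set.not_nonempty_empty
        (δ.nonempty _ _ (h Set.univ ∅
          (fun σ _ => σ.mem_mono σ.nonempty.some_mem (Set.subset_univ _))
          fun σ hσ => hσ.elim)).2
  of_inter := fun _ _ ⟨σ, hS, hT⟩ A B hA hB => σ.near A (hA σ hS) B (hB σ hT)
  union S T U := by
    constructor
    · intro h
      by_contra hn
      push Not at hn
      obtain ⟨⟨A, B, hA, hB, hAB⟩, ⟨A', C, hA', hC, hAC⟩⟩ := hn
      obtain ⟨E, hAE, hEB⟩ := δ.exists_far A B hAB
      obtain ⟨F, hAF, hFC⟩ := δ.exists_far A' C hAC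
      have hEF : Absorbs (E ∪ F)ᶜ S := fun σ hσ =>
        (σ.mem_or_compl_mem (E ∪ F)).resolve_left fun hm =>
          (σ.mem_or_mem E F hm).elim (fun hE => hAE (σ.near A (hA σ hσ) E hE))
            fun hF => hAF (σ.near A' (hA' σ hσ) F hF)
      have hBC : Absorbs (B ∪ C) (T ∪ U) := fun σ hσ =>
        hσ.elim (fun hT => σ.mem_mono (hB σ hT) Set.subset_union_left)
          fun hU => σ.mem_mono (hC σ hU) Set.subset_union_right
      rcases (δ.union _ _ _).mp (h _ _ hEF hBC) with h1 | h1
      · exact hEB (δ.symm _ _ (δ.near_mono (δ.symm _ _ h1)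
          (Set.compl_subset_compl.mpr Set.subset_union_left)))
      · exact hFC (δ.symm _ _ (δ.near_mono (δ.symm _ _ h1)
          (Set.compl_subset_compl.mpr Set.subset_union_right)))
    · rintro (h | h) A B hA hB
      · exact h A B hA fun σ hσ => hB σ (Or.inl hσ)
      · exact h A B hA fun σ hσ => hB σ (Or.inr hσ)
  exists_far S T h := by
    push Not at h
    obtain ⟨A, B, hA, hB, hAB⟩ := h
    obtain ⟨E, hAE, hEB⟩ := δ.exists_far A B hAB
    refine ⟨{σ | E ∈ σ.sets}, fun hn => hAE (hn A E hA fun σ hσ => hσ), fun hn => hEB ?_⟩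
    exact hn Eᶜ B (fun σ hσ => (σ.mem_or_compl_mem E).resolve_left hσ) hB

/-- The metric proximity of a metric space: `A` and `B` are close if and only if
`d(A, B) = inf {d(a, b) | a ∈ A, b ∈ B} = 0` (so the empty set is close to no set). -/
def metric (X : Type u) [MetricSpace X] : Proximity X where
  Near A B := ∀ ε > (0 : ℝ), ∃ a ∈ A, ∃ b ∈ B, dist a b < ε
  symm := fun _ _ h ε hε =>
    let ⟨a, ha, b, hb, hab⟩ := h ε hε
    ⟨b, hb, a, ha, by rwa [dist_comm]⟩
  nonempty := fun _ _ h =>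
    let ⟨a, ha, b, hb, _⟩ := h 1 one_pos
    ⟨⟨a, ha⟩, ⟨b, hb⟩⟩
  of_inter := fun _ _ ⟨x, hA, hB⟩ ε hε => ⟨x, hA, x, hB, by simpa using hε⟩
  union A B C := by
    constructor
    · intro h
      by_contra hn
      push Not at hn
      obtain ⟨⟨ε, hε, h1⟩, ⟨η, hη, h2⟩⟩ := hn
      obtain ⟨a, ha, b, hb, hab⟩ := h (min ε η) (lt_min hε hη)
      rcases hb with hb | hb
      · exact absurd (lt_of_lt_of_le hab (min_le_left _ _)) (not_lt.mpr (h1 a ha b hb))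
      · exact absurd (lt_of_lt_of_le hab (min_le_right _ _)) (not_lt.mpr (h2 a ha b hb))
    · rintro (h | h) ε hε
      · obtain ⟨a, ha, b, hb, hab⟩ := h ε hε
        exact ⟨a, ha, b, Or.inl hb, hab⟩
      · obtain ⟨a, ha, b, hb, hab⟩ := h ε hε
        exact ⟨a, ha, b, Or.inr hb, hab⟩
  exists_far A B h := by
    push Not at h
    obtain ⟨ε, hε, h⟩ := h
    refine ⟨{x | ∃ b ∈ B, dist x b < ε / 2}, fun hn => ?_, fun hn => ?_⟩
    · obtain ⟨a, ha, x, ⟨b, hb, hxb⟩, hax⟩ := hn (ε / 2) (half_pos hε)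
      have := h a ha b hb
      have := dist_triangle a x b
      linarith
    · obtain ⟨x, hx, b, hb, hxb⟩ := hn (ε / 2) (half_pos hε)
      exact hx ⟨b, hb, hxb⟩

end Proximity

namespace Proximity

variable {X : Type u}

/-! A set far from its complement must itself lie in every proximity base
(`IsBase.mem_of_not_near_compl`), so uncountably many such sets force uncountable weight. In the
coproduct every union of summands is of this kind, and infinitely many nonempty summands give an
injective family of them indexed by `Set ℕ`. Passing from `A` to the clusters containing `A` carries
this family to the Smirnov compactification. For a totally bounded metric, a sequence with terms in
distinct summands has a Cauchy subsequence. Its even and odd terms are at distance zero, yet they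
occupy disjoint sets of summands, so the coproduct keeps them apart. -/

theorem aleph0_lt_weight {δ : Proximity X}
    (h : ∀ P : Set (Set X), δ.IsBase P → ¬ P.Countable) : Cardinal.aleph0 < δ.weight := by
  have hne : {κ : Cardinal.{u} | ∃ P : Set (Set X), δ.IsBase P ∧ Cardinal.mk P ≤ κ}.Nonempty :=
    ⟨_, Set.univ, fun A B hAB => ⟨A, trivial, B, trivial, subset_rfl, subset_rfl, hAB⟩, le_rfl⟩
  obtain ⟨P, hP, hκ⟩ := csInf_mem hne
  refine lt_of_lt_of_le ?_ hκ
  rw [← not_le, Cardinal.le_aleph0_iff_set_countable]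
  exact h P hP

/-- A set that is far from its complement belongs to every proximity base. -/
theorem IsBase.mem_of_not_near_compl {δ : Proximity X} {P : Set (Set X)} (hP : δ.IsBase P)
    {A : Set X} (hA : ¬ δ.Near A Aᶜ) : A ∈ P := by
  obtain ⟨C, hC, D, -, hAC, hAD, hCD⟩ := hP _ _ hA
  have hCA : C ⊆ A := fun x hx => by
    by_contra hxA
    exact hCD (δ.of_inter _ _ ⟨x, hx, hAD hxA⟩)
  rwa [hAC.antisymm hCA]

theorem aleph0_lt_weight_of_injective {δ : Proximity X} (f : Set ℕ → Set X)
    (hf : Function.Injective f) (hfar : ∀ J, ¬ δ.Near (f J) (f J)ᶜ) :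
    Cardinal.aleph0 < δ.weight := by
  refine aleph0_lt_weight fun P hP hc => ?_
  have hr : (Set.range f).Countable :=
    hc.mono (Set.range_subset_iff.2 fun J => hP.mem_of_not_near_compl (hfar J))
  have hcount : Countable (Set ℕ) :=
    have := hr.to_subtype
    (Set.rangeFactorization_injective.2 hf).countable
  obtain ⟨g, hg⟩ := exists_injective_nat (Set ℕ)
  exact Function.cantor_injective g hg

/-- The point cluster of `x`: all the sets that are close to `x`. -/
def pointCluster (δ : Proximity X) (x : X) : δ.Cluster where
  sets := {A | δ.Near {x} A}
  nonempty := ⟨{x}, δ.of_inter _ _ ⟨x, rfl, rfl⟩⟩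
  near A hA B hB := by
    by_contra h
    -- `x` lies in `E` or in `Eᶜ`, so closeness to `x` contradicts one of the two separations.
    obtain ⟨E, hAE, hEB⟩ := δ.exists_far A B h
    by_cases hx : x ∈ E
    · exact hAE (δ.near_mono (δ.symm _ _ hA) (Set.singleton_subset_iff.2 hx))
    · exact hEB (δ.symm _ _ (δ.near_mono (δ.symm _ _ hB) (Set.singleton_subset_iff.2 hx)))
  mem_of_near C hC := δ.symm _ _ (hC {x} (δ.of_inter _ _ ⟨x, rfl, rfl⟩))
  mem_or_mem A B h := (δ.union _ _ _).1 h

theorem mem_pointCluster {δ : Proximity X} {x : X} {A : Set X} (hx : x ∈ A) :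
    A ∈ (δ.pointCluster x).sets :=
  δ.of_inter _ _ ⟨x, rfl, hx⟩

theorem mem_of_mem_pointCluster {δ : Proximity X} {x : X} {A : Set X} (hA : ¬ δ.Near A Aᶜ)
    (h : A ∈ (δ.pointCluster x).sets) : x ∈ A := by
  by_contra hx
  exact hA ((δ.pointCluster x).near _ h _ (mem_pointCluster hx))

/-- Every cluster contains `A` or `Aᶜ`, so these two far sets absorb the two sides. -/
theorem smirnov_not_near_compl {δ : Proximity X} {A : Set X} (hA : ¬ δ.Near A Aᶜ) :
    ¬ δ.smirnov.Near {σ | A ∈ σ.sets} {σ | A ∈ σ.sets}ᶜ := fun h =>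
  hA (h A Aᶜ (fun _ hσ => hσ) fun σ hσ => (σ.mem_or_compl_mem A).resolve_left hσ)

/-- Point clusters recover the set: when `A` is far from `Aᶜ`, the cluster of `p` contains `A`
exactly if `p ∈ A`. -/
theorem eq_of_setOf_mem_sets_eq {δ : Proximity X} {A B : Set X} (hA : ¬ δ.Near A Aᶜ)
    (hB : ¬ δ.Near B Bᶜ)
    (h : {σ : δ.Cluster | A ∈ σ.sets} = {σ : δ.Cluster | B ∈ σ.sets}) : A = B := by
  have key (p : X) : A ∈ (δ.pointCluster p).sets ↔ B ∈ (δ.pointCluster p).sets :=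
    Set.ext_iff.1 h (δ.pointCluster p)
  ext p
  exact ⟨fun hp => mem_of_mem_pointCluster hB ((key p).1 (mem_pointCluster hp)),
    fun hp => mem_of_mem_pointCluster hA ((key p).2 (mem_pointCluster hp))⟩

theorem coproduct_near_fst {ι : Type u} {X : ι → Type v} {δ : ∀ i, Proximity (X i)}
    {A B : Set (Σ i, X i)} (h : (coproduct δ).Near A B) :
    (Sigma.fst '' A ∩ Sigma.fst '' B).Nonempty := by
  obtain ⟨i, hi⟩ := h
  obtain ⟨⟨a, ha⟩, ⟨b, hb⟩⟩ := (δ i).nonempty _ _ hi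
  exact ⟨i, ⟨_, ha, rfl⟩, ⟨_, hb, rfl⟩⟩

theorem coproduct_not_near_compl {ι : Type u} {X : ι → Type v} (δ : ∀ i, Proximity (X i))
    (J : Set ι) : ¬ (coproduct δ).Near (Sigma.fst ⁻¹' J) (Sigma.fst ⁻¹' J)ᶜ := by
  intro h
  obtain ⟨_, ⟨a, ha, rfl⟩, ⟨b, hb, hba⟩⟩ := coproduct_near_fst h
  exact hb (show b.1 ∈ J from hba ▸ ha)

/-- The point `x n` witnesses that its summand is nonempty, so testing it recovers whether `n ∈ J`.
-/
theorem preimage_fst_image_injective {ι : Type u} {X : ι → Type v} {x : ℕ → Σ i, X i}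
    (hx : Function.Injective fun n => (x n).1) :
    Function.Injective fun J : Set ℕ =>
      (Sigma.fst ⁻¹' ((fun n => (x n).1) '' J) : Set (Σ i, X i)) := by
  have key : ∀ (J : Set ℕ) (n : ℕ),
      x n ∈ (Sigma.fst ⁻¹' ((fun n => (x n).1) '' J) : Set (Σ i, X i)) ↔ n ∈ J :=
    fun J n => hx.mem_set_image
  intro J K h
  ext n
  rw [← key J, ← key K]
  exact Set.ext_iff.1 h (x n)

theorem metric_near_of_cauchySeq {X : Type u} [MetricSpace X] {y : ℕ → X} (hy : CauchySeq y) :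
    (metric X).Near (y '' {n | Even n}) (y '' {n | ¬ Even n}) := by
  intro ε hε
  obtain ⟨N, hN⟩ := Metric.cauchySeq_iff.1 hy ε hε
  exact ⟨_, ⟨2 * N, by simp, rfl⟩, _, ⟨2 * N + 1, by simp, rfl⟩,
    hN _ (by omega) _ (by omega)⟩

/-- In the completion the closure of the space is compact, so a subsequence converges there; being
Cauchy pulls back along the uniform embedding. -/
theorem exists_cauchySeq_subseq {X : Type u} [MetricSpace X]
    (h : TotallyBounded (Set.univ : Set X)) (x : ℕ → X) :
    ∃ φ : ℕ → ℕ, StrictMono φ ∧ CauchySeq (x ∘ φ) := by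
  have hc : IsCompact (closure (Set.range ((↑) : X → UniformSpace.Completion X))) := by
    refine TotallyBounded.isCompact_of_isClosed ?_ isClosed_closure
    rw [← Set.image_univ]
    exact (h.image (UniformSpace.Completion.uniformContinuous_coe X)).closure
  obtain ⟨a, -, φ, hφ, ha⟩ :=
    hc.tendsto_subseq (x := fun n => (x n : UniformSpace.Completion X))
      fun n => subset_closure ⟨x n, rfl⟩
  refine ⟨φ, hφ, ?_⟩
  exact (UniformSpace.Completion.isUniformInducing_coe X).cauchy_map_iff.1 (by
    rw [Filter.map_map]; exact ha.cauchySeq)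

theorem exists_seq_fst_injective {ι : Type u} {X : ι → Type v}
    (hinf : {i : ι | Nonempty (X i)}.Infinite) :
    ∃ x : ℕ → Σ i, X i, Function.Injective fun n => (x n).1 :=
  ⟨fun n => ⟨hinf.natEmbedding _ n, (hinf.natEmbedding _ n).2.some⟩,
    fun _ _ h => (hinf.natEmbedding _).injective (Subtype.ext h)⟩

end Proximity

open Proximity in
theorem mainTheorem8 {ι : Type u} {X : ι → Type v} (δ : ∀ i, Proximity (X i))
    (hsep : ∀ i, (δ i).Separated) (hinf : {i : ι | Nonempty (X i)}.Infinite) :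
    Cardinal.aleph0 < (Proximity.coproduct δ).weight ∧
    Cardinal.aleph0 < (Proximity.coproduct δ).smirnov.weight ∧
    ∀ m : MetricSpace (Σ i, X i), TotallyBounded (Set.univ : Set (Σ i, X i)) →
      Proximity.coproduct δ ≠ Proximity.metric (Σ i, X i) := by
  obtain ⟨x, hx⟩ := exists_seq_fst_injective hinf
  have hfar (J : Set ℕ) := coproduct_not_near_compl δ ((fun n => (x n).1) '' J)
  refine ⟨aleph0_lt_weight_of_injective _ (preimage_fst_image_injective hx) hfar, ?_, ?_⟩
  · exact aleph0_lt_weight_of_injective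
      (fun J => {σ | (Sigma.fst ⁻¹' ((fun n => (x n).1) '' J) : Set (Σ i, X i)) ∈ σ.sets})
      (fun J K h => preimage_fst_image_injective hx
        (eq_of_setOf_mem_sets_eq (hfar J) (hfar K) h)) fun J => smirnov_not_near_compl (hfar J)
  · intro m htb heq
    obtain ⟨φ, hφ, hc⟩ := exists_cauchySeq_subseq htb x
    have hnear := metric_near_of_cauchySeq hc
    rw [← heq] at hnear
    obtain ⟨_, ⟨_, ⟨a, ha, rfl⟩, rfl⟩, ⟨_, ⟨b, hb, rfl⟩, hba⟩⟩ := coproduct_near_fst hnear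
    -- A shared summand forces equal indices `a = b`, one even and the other odd.
    exact hb (hφ.injective (hx hba) ▸ ha)
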